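/- Let $K\subset[0,1]$ be the middle-third Cantor set, that is, the set of all $x=\sum_{k=1}^\infty \alpha_k 3^{-k}$ with $\alpha_k\in\{0,2\}$ for every $k\geq 1$, let $P:\mathbb{R}^2\to\mathbb{R}$ be $P(x,y)=xy$, and let $\mathcal{L}$ denote Lebesgue measure on $\mathbb{R}$. Then $$ \left|\mathcal{L}\big(P(K\times K)\big)-\frac{91782451}{113374080}\right|\leq\frac{1}{10^{6}}, $$ where $P(K\times K)=\{xy : x,y\in K\}$. -/

import Mathlib

open MeasureTheory

/-!
Write `C(a, s) = a + s • cantorSet`. Splitting off the left third of the Cantor set `K` gives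
`K * K = (1/3) • (K * K) ∪ Q` with `Q = C(2/3, 1/3) * C(2/3, 1/3) ⊆ [4/9, 1]`, a disjoint union, so
that `|K * K| = (3/2) |Q|`, and it remains to measure the gaps of `Q` in `[4/9, 1]`.

Two cells of equal size that are separated by at least their size, and are not too far apart in
ratio, have the full interval as their product set (`cantorCopy_mul_cantorCopy`). Therefore, in the
product of a cell `C(a, 3 t)` with itself, the mixed products of the two halves fill the interval
`J = [a (a + 2 t), (a + t) (a + 3 t)]`, and only the two diagonal products have to be subdivided
further (`selfProduct_three_mul`). Each cell thus opens one gap of length `t ^ 2` between `J` and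
the product of the right half with itself. If these gaps were all that matters, a cell of size `s`
would have gaps of total length `∑ 2 ^ k (s / 3 ^ (k + 1)) ^ 2 = s ^ 2 / 7`, which is always an
upper bound (`gapLength_le`) and would give `|K * K| = 17/21`.

The correction comes from the overlap, of length `t ^ 2`, of `J` with the hull of the product of
the left half with itself: the gaps of the left half in this overlap are filled. They lie in the
product of its rightmost cell of size `t ^ 2` with itself, so their length is at most `t ^ 4 / 7`
(`volume_overlap_le`), and for the top cell, `t = 1/9`, at most `8 t ^ 4 / 63`
(`volume_overlap_right_third_le`). Conversely, they lower the upper bound `(3 t) ^ 2 / 7` by at least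
`8 t ^ 4 / 63` (`gapLength_le_sub_add`). Taking this into account for the top cell and its right
half bounds the gaps of `Q` from above
(`gapLength_right_third_le`); the bound for the top overlap and the sum of `t ^ 4 / 7` over the
remaining cells bound them from below (`le_gapLength_right_third`). The two bounds are close enough.
-/

open scoped Pointwise

/-! ### Affine copies of the Cantor set -/

/-- The affine copy `a + s • cantorSet` of the Cantor set, with convex hull `[a, a + s]`. -/
noncomputable def cantorCopy (a s : ℝ) : Set ℝ := (fun x ↦ a + s * x) '' cantorSet

lemma isCompact_cantorCopy (a s : ℝ) : IsCompact (cantorCopy a s) :=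
  isCompact_cantorSet.image (by fun_prop)

lemma cantorCopy_subset_Icc {a s : ℝ} (hs : 0 ≤ s) : cantorCopy a s ⊆ Set.Icc a (a + s) := by
  rintro _ ⟨x, hx, rfl⟩
  obtain ⟨h0, h1⟩ := cantorSet_subset_unitInterval hx
  constructor <;> simp only <;> nlinarith

lemma left_mem_cantorCopy (a s : ℝ) : a ∈ cantorCopy a s :=
  ⟨0, zero_mem_cantorSet, by simp⟩

lemma cantorCopy_three_mul (a t : ℝ) :
    cantorCopy a (3 * t) = cantorCopy a t ∪ cantorCopy (a + 2 * t) t := by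
  have h : cantorCopy a (3 * t) = (fun x ↦ a + 3 * t * x) ''
      ((· / 3) '' cantorSet ∪ (fun x ↦ (2 + x) / 3) '' cantorSet) := by
    rw [← cantorSet_eq_union_halves]; rfl
  rw [h, Set.image_union, Set.image_image, Set.image_image]
  congr 1 <;> exact Set.image_congr fun x _ ↦ by ring

/-- The rightmost cells of a copy of the Cantor set, of sizes `r, 3 r, 9 r, …`, are nested. -/
lemma cantorCopy_right_subset (e r : ℝ) (k : ℕ) :
    cantorCopy (e - r) r ⊆ cantorCopy (e - 3 ^ k * r) (3 ^ k * r) := by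
  induction k with
  | zero => simp
  | succ k ih =>
    have h := cantorCopy_three_mul (e - 3 * (3 ^ k * r)) (3 ^ k * r)
    rw [show e - 3 * (3 ^ k * r) + 2 * (3 ^ k * r) = e - 3 ^ k * r by ring] at h
    rw [pow_succ', mul_assoc, h]
    exact ih.trans Set.subset_union_right

/-! ### Products of separated copies -/

/-- The four products of halves of two separated cells cover the product of the hulls, and the
halves are separated again; hence every point of the product of the hulls is approximated by
products of left endpoints of small cells. -/
lemma exists_mul_near {a b s y : ℝ} (n : ℕ) (hs : 0 < s) (hb : 0 < b) (hab : b + s ≤ a)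
    (hba : a + s ≤ 3 * b) (ha : a + s ≤ 1) (hy : a * b ≤ y) (hy' : y ≤ (a + s) * (b + s)) :
    ∃ p ∈ cantorCopy a s, ∃ q ∈ cantorCopy b s, |y - p * q| ≤ 2 * s / 3 ^ n := by
  induction n generalizing a b s with
  | zero =>
    refine ⟨a, left_mem_cantorCopy a s, b, left_mem_cantorCopy b s, ?_⟩
    rw [abs_of_nonneg (by linarith)]
    simp only [pow_zero, div_one]
    nlinarith
  | succ n ih =>
    obtain ⟨t, rfl⟩ : ∃ t, s = 3 * t := ⟨s / 3, by ring⟩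
    have ht : 0 < t := by linarith
    rw [cantorCopy_three_mul, cantorCopy_three_mul,
      show 2 * (3 * t) / (3 : ℝ) ^ (n + 1) = 2 * t / 3 ^ n by field_simp; ring]
    rcases le_total y ((a + t) * (b + t)) with h1 | h1
    · obtain ⟨p, hp, q, hq, h⟩ := ih ht hb (by linarith) (by linarith) (by linarith) hy h1
      exact ⟨p, .inl hp, q, .inl hq, h⟩
    rcases le_total y ((a + 3 * t) * (b + t)) with h2 | h2
    · obtain ⟨p, hp, q, hq, h⟩ := ih (a := a + 2 * t) ht hb (by linarith) (by linarith)
        (by linarith) (by nlinarith) (by linarith)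
      exact ⟨p, .inr hp, q, .inl hq, h⟩
    rcases le_total y ((a + t) * (b + 3 * t)) with h3 | h3
    · obtain ⟨p, hp, q, hq, h⟩ := ih (a := a) (b := b + 2 * t) ht (by linarith) (by linarith)
        (by linarith) (by linarith) (by nlinarith) (by linarith)
      exact ⟨p, .inl hp, q, .inr hq, h⟩
    · obtain ⟨p, hp, q, hq, h⟩ := ih (a := a + 2 * t) (b := b + 2 * t) ht (by linarith)
        (by linarith) (by linarith) (by linarith) (by nlinarith) (by linarith)
      exact ⟨p, .inr hp, q, .inr hq, h⟩

lemma cantorCopy_mul_cantorCopy {a b s : ℝ} (hs : 0 < s) (hb : 0 < b) (hab : b + s ≤ a)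
    (hba : a + s ≤ 3 * b) (ha : a + s ≤ 1) :
    cantorCopy a s * cantorCopy b s = Set.Icc (a * b) ((a + s) * (b + s)) := by
  apply Set.Subset.antisymm
  · rintro _ ⟨p, hp, q, hq, rfl⟩
    obtain ⟨hp0, hp1⟩ := cantorCopy_subset_Icc hs.le hp
    obtain ⟨hq0, hq1⟩ := cantorCopy_subset_Icc hs.le hq
    exact ⟨mul_le_mul hp0 hq0 hb.le (by linarith), mul_le_mul hp1 hq1 (by linarith) (by linarith)⟩
  · rintro y ⟨hy, hy'⟩
    have hcl : IsClosed (cantorCopy a s * cantorCopy b s) :=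
      ((isCompact_cantorCopy a s).mul (isCompact_cantorCopy b s)).isClosed
    rw [← hcl.closure_eq, Metric.mem_closure_iff]
    intro ε hε
    obtain ⟨n, hn⟩ := exists_pow_lt_of_lt_one (show 0 < ε / (2 * s) by positivity)
      (show (1 / 3 : ℝ) < 1 by norm_num)
    obtain ⟨p, hp, q, hq, h⟩ := exists_mul_near n hs hb hab hba ha hy hy'
    refine ⟨p * q, Set.mul_mem_mul hp hq, ?_⟩
    rw [Real.dist_eq]
    refine h.trans_lt ?_
    rw [lt_div_iff₀ (by positivity), one_div, inv_pow] at hn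
    rw [div_eq_mul_inv]
    linarith

/-! ### The gaps in the product of a copy with itself -/

/-- The set of products of two points of `cantorCopy a s`. -/
noncomputable def selfProduct (a s : ℝ) : Set ℝ := cantorCopy a s * cantorCopy a s

lemma isCompact_selfProduct (a s : ℝ) : IsCompact (selfProduct a s) :=
  (isCompact_cantorCopy a s).mul (isCompact_cantorCopy a s)

lemma measurableSet_selfProduct (a s : ℝ) : MeasurableSet (selfProduct a s) :=
  (isCompact_selfProduct a s).isClosed.measurableSet

lemma selfProduct_subset_Icc {a s : ℝ} (ha : 0 ≤ a) (hs : 0 ≤ s) :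
    selfProduct a s ⊆ Set.Icc (a ^ 2) ((a + s) ^ 2) := by
  rintro _ ⟨p, hp, q, hq, rfl⟩
  obtain ⟨hp0, hp1⟩ := cantorCopy_subset_Icc hs hp
  obtain ⟨hq0, hq1⟩ := cantorCopy_subset_Icc hs hq
  rw [sq, sq]
  exact ⟨mul_le_mul hp0 hq0 ha (by linarith), mul_le_mul hp1 hq1 (by linarith) (by linarith)⟩

/-- The mixed products of the two halves fill an interval, so that only the two diagonal cells
have to be subdivided further. -/
lemma selfProduct_three_mul {a t : ℝ} (ha : 2 / 3 ≤ a) (ht : 0 < t) (h1 : a + 3 * t ≤ 1) :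
    selfProduct a (3 * t) = selfProduct a t ∪
      Set.Icc (a * (a + 2 * t)) ((a + t) * (a + 3 * t)) ∪ selfProduct (a + 2 * t) t := by
  have h := cantorCopy_mul_cantorCopy (a := a + 2 * t) (b := a) ht (by linarith) (by linarith)
    (by linarith) (by linarith)
  rw [selfProduct, cantorCopy_three_mul, Set.union_mul, Set.mul_union, Set.mul_union,
    mul_comm (cantorCopy a t) (cantorCopy (a + 2 * t) t), h, selfProduct, selfProduct,
    show (a + 2 * t) * a = a * (a + 2 * t) by ring,
    show (a + 2 * t + t) * (a + t) = (a + t) * (a + 3 * t) by ring]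
  grind

/-- The total length of the part of `[a ^ 2, y]` that `selfProduct a s` misses. -/
noncomputable def gapLengthUpTo (a s y : ℝ) : ℝ :=
  volume.real (Set.Icc (a ^ 2) y \ selfProduct a s)

/-- The total length of the gaps of `selfProduct a s` in its convex hull. -/
noncomputable def gapLength (a s : ℝ) : ℝ := gapLengthUpTo a s ((a + s) ^ 2)

lemma gapLength_nonneg (a s : ℝ) : 0 ≤ gapLength a s := measureReal_nonneg

lemma measure_Icc_sdiff_ne_top (x y : ℝ) (A : Set ℝ) : volume (Set.Icc x y \ A) ≠ ⊤ :=
  measure_ne_top_of_subset Set.sdiff_subset (by simp)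

lemma volume_selfProduct {a s : ℝ} (ha : 0 ≤ a) (hs : 0 ≤ s) :
    volume.real (selfProduct a s) = (a + s) ^ 2 - a ^ 2 - gapLength a s := by
  rw [gapLength, gapLengthUpTo, measureReal_sdiff (selfProduct_subset_Icc ha hs)
    (measurableSet_selfProduct a s) (by simp), Real.volume_real_Icc_of_le (by gcongr; linarith)]
  ring

/-! ### Upper bounds for the gaps -/

lemma gapLengthUpTo_le_gapLength {a s y : ℝ} (hy : y ≤ (a + s) ^ 2) :
    gapLengthUpTo a s y ≤ gapLength a s :=
  measureReal_mono (Set.sdiff_subset_sdiff_left (Set.Icc_subset_Icc_right hy))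
    (measure_Icc_sdiff_ne_top _ _ _)

/-- Apart from the gaps inside the two diagonal cells, there is one gap of length `t ^ 2`, just
below the right diagonal cell. In the left cell, only the gaps below the interval of mixed products
remain. -/
lemma gapLengthUpTo_le_add {a t y : ℝ} (ha : 2 / 3 ≤ a) (ht : 0 < t) (h1 : a + 3 * t ≤ 1) :
    gapLengthUpTo a (3 * t) y ≤
      gapLengthUpTo a t (a * (a + 2 * t)) + t ^ 2 + gapLengthUpTo (a + 2 * t) t y := by
  have hsub : Set.Icc (a ^ 2) y \ selfProduct a (3 * t) ⊆
      (Set.Icc (a ^ 2) (a * (a + 2 * t)) \ selfProduct a t ∪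
        Set.Icc ((a + t) * (a + 3 * t)) ((a + 2 * t) ^ 2)) ∪
      (Set.Icc ((a + 2 * t) ^ 2) y \ selfProduct (a + 2 * t) t) := by
    rw [selfProduct_three_mul ha ht h1]
    rintro x ⟨⟨hx0, hx1⟩, hx⟩
    simp only [Set.mem_union, Set.mem_Icc, not_or, not_and, not_le] at hx
    simp only [Set.mem_union, Set.mem_sdiff, Set.mem_Icc]
    grind
  calc gapLengthUpTo a (3 * t) y ≤ _ :=
        measureReal_mono hsub (by simp [measure_Icc_sdiff_ne_top])
    _ ≤ _ := measureReal_union_le _ _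
    _ ≤ _ := add_le_add_left (measureReal_union_le _ _) _
    _ = _ := by
      rw [Real.volume_real_Icc_of_le (by nlinarith)]
      simp only [gapLengthUpTo]
      ring

lemma gapLength_le_upTo_add {a t : ℝ} (ha : 2 / 3 ≤ a) (ht : 0 < t) (h1 : a + 3 * t ≤ 1) :
    gapLength a (3 * t) ≤
      gapLengthUpTo a t (a * (a + 2 * t)) + t ^ 2 + gapLength (a + 2 * t) t := by
  have h := gapLengthUpTo_le_add (y := (a + 3 * t) ^ 2) ha ht h1
  rw [gapLength, gapLength.eq_def (a + 2 * t)]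
  convert h using 3
  ring

lemma gapLength_le_add {a t : ℝ} (ha : 2 / 3 ≤ a) (ht : 0 < t) (h1 : a + 3 * t ≤ 1) :
    gapLength a (3 * t) ≤ gapLength a t + t ^ 2 + gapLength (a + 2 * t) t := by
  have h := gapLength_le_upTo_add ha ht h1
  have h' := gapLengthUpTo_le_gapLength (a := a) (s := t) (y := a * (a + 2 * t)) (by nlinarith)
  linarith

lemma gapLength_le_hull {a s : ℝ} (ha : 0 ≤ a) (hs : 0 ≤ s) :
    gapLength a s ≤ (a + s) ^ 2 - a ^ 2 := by
  have := volume_selfProduct ha hs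
  have : 0 ≤ volume.real (selfProduct a s) := measureReal_nonneg
  linarith

lemma gapLength_le_add_pow (n : ℕ) {a s : ℝ} (ha : 2 / 3 ≤ a) (hs : 0 < s) (h1 : a + s ≤ 1) :
    gapLength a s ≤ s ^ 2 / 7 + 2 * s * (2 / 3) ^ n := by
  induction n generalizing a s with
  | zero =>
    have := gapLength_le_hull (a := a) (by linarith) hs.le
    nlinarith
  | succ n ih =>
    obtain ⟨t, rfl⟩ : ∃ t, s = 3 * t := ⟨s / 3, by ring⟩
    have := gapLength_le_add ha (by linarith) h1
    have := ih (a := a) (s := t) ha (by linarith) (by linarith)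
    have := ih (a := a + 2 * t) (s := t) (by linarith) (by linarith) (by linarith)
    rw [pow_succ (2 / 3 : ℝ)]
    linarith

/-- The gaps opened by the `2 ^ k` cells of size `s / 3 ^ k` have length `(s / 3 ^ (k + 1)) ^ 2`
each, and the sum over all `k` is `s ^ 2 / 7`. -/
lemma gapLength_le {a s : ℝ} (ha : 2 / 3 ≤ a) (hs : 0 < s) (h1 : a + s ≤ 1) :
    gapLength a s ≤ s ^ 2 / 7 := by
  have hlim : Filter.Tendsto (fun n : ℕ ↦ s ^ 2 / 7 + 2 * s * (2 / 3 : ℝ) ^ n) Filter.atTop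
      (nhds (s ^ 2 / 7 + 2 * s * 0)) :=
    ((tendsto_pow_atTop_nhds_zero_of_lt_one (by norm_num) (by norm_num)).const_mul _).const_add _
  simpa using ge_of_tendsto' hlim fun n ↦ gapLength_le_add_pow n ha hs h1

/-- If the interval of mixed products of the rightmost cell of size `r` reaches up to `y`, then the
part below `y` avoids the gap opened by this cell and the gaps in the right half of the cell. -/
lemma gapLengthUpTo_le {e r y : ℝ} (k : ℕ) (he : 2 / 3 ≤ e - 3 ^ k * r) (he1 : e ≤ 1) (hr : 0 < r)
    (hy : y ≤ (e - 2 / 3 * r) * e) :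
    gapLengthUpTo (e - 3 ^ k * r) (3 ^ k * r) y ≤ (3 ^ k * r) ^ 2 / 7 - 8 / 63 * r ^ 2 := by
  induction k with
  | zero =>
    simp only [pow_zero, one_mul] at he ⊢
    obtain ⟨t, rfl⟩ : ∃ t, r = 3 * t := ⟨r / 3, by ring⟩
    have hsub : Set.Icc ((e - 3 * t) ^ 2) y \ selfProduct (e - 3 * t) (3 * t) ⊆
        Set.Icc ((e - 3 * t) ^ 2) ((e - 3 * t + t) ^ 2) \ selfProduct (e - 3 * t) t := by
      rw [selfProduct_three_mul he (by linarith) (by linarith)]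
      rintro x ⟨⟨hx0, hx1⟩, hx⟩
      simp only [Set.mem_union, Set.mem_Icc, not_or, not_and, not_le] at hx
      refine ⟨⟨hx0, ?_⟩, hx.1.1⟩
      by_contra! h
      have h2 := hx.1.2 (by nlinarith)
      have h3 : (e - 3 * t + t) * (e - 3 * t + 3 * t) = (e - 2 / 3 * (3 * t)) * e := by ring
      linarith
    calc gapLengthUpTo _ _ y ≤ gapLength (e - 3 * t) t :=
          measureReal_mono hsub (measure_Icc_sdiff_ne_top _ _ _)
      _ ≤ t ^ 2 / 7 := gapLength_le he (by linarith) (by linarith)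
      _ = _ := by ring
  | succ k ih =>
    have hp : 0 < 3 ^ k * r := by positivity
    rw [pow_succ', mul_assoc] at he ⊢
    have h1 := gapLengthUpTo_le_add (y := y) he hp (by linarith)
    have h0 := gapLengthUpTo_le_gapLength (a := e - 3 * (3 ^ k * r)) (s := 3 ^ k * r)
      (y := (e - 3 * (3 ^ k * r)) * (e - 3 * (3 ^ k * r) + 2 * (3 ^ k * r)))
      (by nlinarith [sq_nonneg (3 ^ k * r)])
    have h2 := gapLength_le (s := 3 ^ k * r) he hp (by linarith)
    rw [show e - 3 * (3 ^ k * r) + 2 * (3 ^ k * r) = e - 3 ^ k * r by ring] at h0 h1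
    have h3 := ih (by linarith)
    linarith

/-- The interval of mixed products fills at least one gap of length `t ^ 4 / 9`, and the gaps above
it, near the top of the left diagonal cell. -/
lemma gapLength_le_sub_add {a t : ℝ} (k : ℕ) (ha : 2 / 3 ≤ a) (ht : 0 < t) (h1 : a + 3 * t ≤ 1)
    (hk : 3 ^ k * t = 1) :
    gapLength a (3 * t) ≤ t ^ 2 / 7 - 8 / 63 * t ^ 4 + t ^ 2 + gapLength (a + 2 * t) t := by
  have h2 := gapLength_le_upTo_add ha ht h1
  -- the rightmost cell of size `t ^ 2` of the left half always meets the hypothesis on `y`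
  have hkt : 3 ^ k * t ^ 2 = t := by rw [sq, ← mul_assoc, hk, one_mul]
  have h4 := gapLengthUpTo_le (e := a + t) (r := t ^ 2) (y := a * (a + 2 * t)) k
    (by rw [hkt]; linarith) (by linarith) (by positivity) (by nlinarith [sq_nonneg t])
  rw [hkt, add_sub_cancel_right] at h4
  linarith

/-! ### Lower bounds for the gaps -/

/-- The gaps of the left diagonal cell that lie above the start of the interval of mixed products
are the only ones that get filled. -/
lemma add_sub_le_gapLength {a t : ℝ} (ha : 2 / 3 ≤ a) (ht : 0 < t) (h1 : a + 3 * t ≤ 1) :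
    gapLength a t + t ^ 2 + gapLength (a + 2 * t) t -
        volume.real (Set.Icc (a * (a + 2 * t)) ((a + t) ^ 2) \ selfProduct a t) ≤
      gapLength a (3 * t) := by
  set A := Set.Ico (a ^ 2) (a * (a + 2 * t)) \ selfProduct a t
  set B := Set.Ioo ((a + t) * (a + 3 * t)) ((a + 2 * t) ^ 2)
  set C := Set.Icc ((a + 2 * t) ^ 2) ((a + 2 * t + t) ^ 2) \ selfProduct (a + 2 * t) t
  have hat : a * (a + 2 * t) ≤ (a + t) ^ 2 := by nlinarith
  have hat2 : (a + t) ^ 2 ≤ (a + t) * (a + 3 * t) := by nlinarith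
  have hat3 : (a + t) * (a + 3 * t) ≤ (a + 2 * t) ^ 2 := by nlinarith
  have hat4 : (a + 2 * t) ^ 2 ≤ (a + 3 * t) ^ 2 := by nlinarith
  have hat0 : a ^ 2 ≤ a * (a + 2 * t) := by nlinarith
  have hA : volume A ≠ ⊤ := measure_ne_top_of_subset Set.sdiff_subset (by simp)
  have hB : volume B ≠ ⊤ := by simp [B]
  have hC : volume C ≠ ⊤ := measure_Icc_sdiff_ne_top _ _ _
  have hleft : gapLength a t ≤ volume.real A +
      volume.real (Set.Icc (a * (a + 2 * t)) ((a + t) ^ 2) \ selfProduct a t) := by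
    refine (measureReal_mono ?_ (measure_union_ne_top hA (measure_Icc_sdiff_ne_top _ _ _))).trans
      (measureReal_union_le _ _)
    rintro x ⟨⟨hx0, hx1⟩, hx⟩
    simp only [A, Set.mem_union, Set.mem_sdiff, Set.mem_Icc, Set.mem_Ico]
    grind
  have hsub : (A ∪ B) ∪ C ⊆ Set.Icc (a ^ 2) ((a + 3 * t) ^ 2) \ selfProduct a (3 * t) := by
    rw [selfProduct_three_mul ha ht h1]
    have hQ1 := selfProduct_subset_Icc (a := a) (s := t) (by linarith) ht.le
    have hQ2 := selfProduct_subset_Icc (a := a + 2 * t) (s := t) (by linarith) ht.le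
    have hQ1' : ∀ x ∈ selfProduct a t, x ≤ (a + t) ^ 2 := fun x hx ↦ (hQ1 hx).2
    have hQ2' : ∀ x ∈ selfProduct (a + 2 * t) t, (a + 2 * t) ^ 2 ≤ x := fun x hx ↦ (hQ2 hx).1
    rintro x hx
    simp only [A, B, C, Set.mem_union, Set.mem_sdiff, Set.mem_Icc, Set.mem_Ico, Set.mem_Ioo,
      show a + 2 * t + t = a + 3 * t by ring] at hx
    simp only [Set.mem_union, Set.mem_sdiff, Set.mem_Icc]
    rcases hx with (⟨⟨hx0, hx1⟩, hx⟩ | ⟨hx0, hx1⟩) | ⟨⟨hx0, hx1⟩, hx⟩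
    · refine ⟨⟨hx0, by linarith⟩, ?_⟩
      rintro ((h | h) | h)
      · exact hx h
      · linarith [h.1]
      · linarith [hQ2' x h]
    · refine ⟨⟨by linarith, by linarith⟩, ?_⟩
      rintro ((h | h) | h)
      · linarith [hQ1' x h]
      · linarith [h.2]
      · linarith [hQ2' x h]
    · refine ⟨⟨by linarith, hx1⟩, ?_⟩
      rintro ((h | h) | h)
      · nlinarith [hQ1' x h]
      · nlinarith [h.2]
      · exact hx h
  have hAB : Disjoint A B := by
    refine Set.disjoint_left.2 fun x hx hx' ↦ ?_
    have h2 := hx.1.2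
    have h3 := hx'.1
    linarith
  have hABC : Disjoint (A ∪ B) C := by
    refine Set.disjoint_left.2 fun x hx hx' ↦ ?_
    have h3 := hx'.1.1
    rcases hx with hx | hx
    · have h2 := hx.1.2
      linarith
    · have h2 := hx.2
      linarith
  have hBC : volume.real A + volume.real B + volume.real C ≤ gapLength a (3 * t) := by
    rw [← measureReal_union hAB measurableSet_Ioo hA hB,
      ← measureReal_union hABC (measurableSet_Icc.diff (measurableSet_selfProduct _ _))
        (measure_union_ne_top hA hB) hC]
    exact measureReal_mono hsub (measure_Icc_sdiff_ne_top _ _ _)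
  have hBv : volume.real B = t ^ 2 := by
    rw [Real.volume_real_Ioo_of_le hat3]; ring
  have hCv : volume.real C = gapLength (a + 2 * t) t := rfl
  linarith

/-- The filled gaps of the left diagonal cell lie inside the rightmost cell of size `t ^ 2`. -/
lemma volume_overlap_le {a t : ℝ} (k : ℕ) (ha : 2 / 3 ≤ a) (ht : 0 < t) (h1 : a + 3 * t ≤ 1)
    (hk : 3 ^ k * t = 1) :
    volume.real (Set.Icc (a * (a + 2 * t)) ((a + t) ^ 2) \ selfProduct a t) ≤ t ^ 4 / 7 := by
  have hkt : 3 ^ k * t ^ 2 = t := by rw [sq, ← mul_assoc, hk, one_mul]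
  have hsub := cantorCopy_right_subset (a + t) (t ^ 2) k
  rw [hkt, add_sub_cancel_right] at hsub
  refine (measureReal_mono ?_ (measure_Icc_sdiff_ne_top _ _ _)).trans
    ((gapLength_le (a := a + t - t ^ 2) (s := t ^ 2) ?_ ?_ ?_).trans_eq (by ring))
  · rw [sub_add_cancel]
    refine Set.sdiff_subset_sdiff (Set.Icc_subset_Icc_left ?_) (Set.mul_subset_mul hsub hsub)
    nlinarith [sq_nonneg t, mul_pos ht ht, mul_pos (mul_pos ht ht) ht]
  · nlinarith
  · positivity
  · linarith

lemma le_gapLength_of_pow (n k : ℕ) {a s : ℝ} (ha : 2 / 3 ≤ a) (h1 : a + s ≤ 1) (hs : 0 < s)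
    (hk : 3 ^ k * s = 1) :
    s ^ 2 / 7 * (1 - (2 / 9) ^ n) - s ^ 4 / 553 ≤ gapLength a s := by
  induction n generalizing k a s with
  | zero =>
    have := gapLength_nonneg a s
    have : 0 ≤ s ^ 4 := by positivity
    simp only [pow_zero]
    linarith
  | succ n ih =>
    obtain ⟨t, rfl⟩ : ∃ t, s = 3 * t := ⟨s / 3, by ring⟩
    have hk' : 3 ^ (k + 1) * t = 1 := by rw [← hk]; ring
    have := add_sub_le_gapLength ha (by linarith) h1
    have := volume_overlap_le (k + 1) ha (by linarith) h1 hk'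
    have := ih (k + 1) (a := a) (s := t) ha (by linarith) (by linarith) hk'
    have := ih (k + 1) (a := a + 2 * t) (s := t) (by linarith) (by linarith) (by linarith) hk'
    rw [pow_succ (2 / 9 : ℝ)]
    ring_nf at *
    linarith

/-- The constant `553 = 7 * 79` is the one for which the error terms `s ^ 4 / 553` of the two halves
and the bound for the overlap add up to the error term of the whole cell. -/
lemma le_gapLength (k : ℕ) {a s : ℝ} (ha : 2 / 3 ≤ a) (h1 : a + s ≤ 1) (hs : 0 < s)
    (hk : 3 ^ k * s = 1) : s ^ 2 / 7 - s ^ 4 / 553 ≤ gapLength a s := by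
  have hlim : Filter.Tendsto (fun n : ℕ ↦ s ^ 2 / 7 * (1 - (2 / 9 : ℝ) ^ n) - s ^ 4 / 553)
      Filter.atTop (nhds (s ^ 2 / 7 * (1 - 0) - s ^ 4 / 553)) :=
    (((tendsto_pow_atTop_nhds_zero_of_lt_one (by norm_num) (by norm_num)).const_sub _).const_mul
      _).sub_const _
  simpa using le_of_tendsto' hlim fun n ↦ le_gapLength_of_pow n k ha h1 hs hk

/-! ### The right third of the Cantor set -/

/-- In the cell `[2/3, 7/9]` all gaps of products above `48/81` come from one gap of length
`3 ^ (-10)` and the gaps of the cell `[188/243, 7/9]`. -/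
lemma volume_overlap_right_third_le :
    volume.real (Set.Icc (48 / 81) (49 / 81) \ selfProduct (2 / 3) (1 / 9)) ≤
      8 / 7 * (1 / 3) ^ 10 := by
  have hsub := cantorCopy_right_subset (7 / 9) (1 / 81) 2
  norm_num at hsub
  have hQ := selfProduct_three_mul (a := 62 / 81) (t := 1 / 243) (by norm_num) (by norm_num)
    (by norm_num)
  norm_num at hQ
  have hQsub : selfProduct (62 / 81) (1 / 81) ⊆ selfProduct (2 / 3) (1 / 9) :=
    Set.mul_subset_mul hsub hsub
  rw [hQ] at hQsub
  have hgap := gapLength_le (a := 188 / 243) (s := 1 / 243) (by norm_num) (by norm_num)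
    (by norm_num)
  have hcover : Set.Icc (48 / 81 : ℝ) (49 / 81) \ selfProduct (2 / 3) (1 / 9) ⊆
      Set.Icc (3927 / 6561) ((188 / 243) ^ 2) ∪
        (Set.Icc ((188 / 243) ^ 2) ((188 / 243 + 1 / 243) ^ 2) \
          selfProduct (188 / 243) (1 / 243)) := by
    rintro x ⟨⟨hx0, hx1⟩, hx⟩
    have h1 : x ∉ Set.Icc (11656 / 19683 : ℝ) (1309 / 2187) := fun h ↦ hx (hQsub (.inl (.inr h)))
    have h2 : x ∉ selfProduct (188 / 243) (1 / 243) := fun h ↦ hx (hQsub (.inr h))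
    simp only [Set.mem_Icc, not_and, not_le] at h1
    simp only [Set.mem_union, Set.mem_sdiff, Set.mem_Icc]
    norm_num
    grind
  calc _ ≤ _ := measureReal_mono hcover
        (measure_union_ne_top (by simp) (measure_Icc_sdiff_ne_top _ _ _))
    _ ≤ _ := measureReal_union_le _ _
    _ ≤ ((188 / 243) ^ 2 - 3927 / 6561) + (1 / 243) ^ 2 / 7 := by
      gcongr
      · rw [Real.volume_real_Icc_of_le (by norm_num)]
      · exact hgap
    _ = _ := by norm_num

lemma gapLength_right_third_le :
    gapLength (2 / 3) (1 / 3) ≤ 1 / 63 - 8 / 7 * (1 / 3) ^ 10 - 8 / 63 * (1 / 3) ^ 12 := by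
  have h := gapLength_le_sub_add 2 (a := 2 / 3) (t := 1 / 9) (by norm_num) (by norm_num)
    (by norm_num) (by norm_num)
  have h1 := gapLength_le_sub_add 3 (a := 8 / 9) (t := 1 / 27) (by norm_num) (by norm_num)
    (by norm_num) (by norm_num)
  have h2 := gapLength_le (a := 26 / 27) (s := 1 / 27) (by norm_num) (by norm_num) (by norm_num)
  norm_num at *
  linarith

lemma le_gapLength_right_third :
    1 / 63 - 8 / 7 * (1 / 3) ^ 10 - 2 / 553 * (1 / 9) ^ 4 ≤ gapLength (2 / 3) (1 / 3) := by
  have h := add_sub_le_gapLength (a := 2 / 3) (t := 1 / 9) (by norm_num) (by norm_num)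
    (by norm_num)
  have h0 := volume_overlap_right_third_le
  have h1 := le_gapLength 2 (a := 2 / 3) (s := 1 / 9) (by norm_num) (by norm_num) (by norm_num)
    (by norm_num)
  have h2 := le_gapLength 2 (a := 8 / 9) (s := 1 / 9) (by norm_num) (by norm_num) (by norm_num)
    (by norm_num)
  norm_num at *
  linarith

/-! ### Self-similarity -/

/-- A product with a factor in the left third of the Cantor set is a third of another product; the
remaining products are those of the right third. -/
lemma cantorSet_mul_cantorSet :
    cantorSet * cantorSet =
      (1 / 3 : ℝ) • (cantorSet * cantorSet) ∪ selfProduct (2 / 3) (1 / 3) := by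
  have h3 : cantorSet = (1 / 3 : ℝ) • cantorSet ∪ cantorCopy (2 / 3) (1 / 3) := by
    conv_lhs => rw [cantorSet_eq_union_halves]
    congr 1 <;> refine Set.image_congr fun x _ ↦ ?_ <;> first | (rw [smul_eq_mul]; ring) | ring
  apply Set.Subset.antisymm
  · rintro _ ⟨x, hx, y, hy, rfl⟩
    have hx' := hx
    have hy' := hy
    rw [h3] at hx' hy'
    rcases hx' with ⟨u, hu, rfl⟩ | hx'
    · exact .inl ⟨u * y, Set.mul_mem_mul hu hy, by simp only [smul_eq_mul]; ring⟩
    rcases hy' with ⟨v, hv, rfl⟩ | hy'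
    · exact .inl ⟨x * v, Set.mul_mem_mul hx hv, by simp only [smul_eq_mul]; ring⟩
    exact .inr (Set.mul_mem_mul hx' hy')
  · refine Set.union_subset ?_ ?_
    · rintro _ ⟨_, ⟨x, hx, y, hy, rfl⟩, rfl⟩
      refine ⟨(1 / 3 : ℝ) • x, ?_, y, hy, by simp only [smul_eq_mul]; ring⟩
      rw [h3]
      exact .inl (Set.smul_mem_smul_set hx)
    · have h : cantorCopy (2 / 3) (1 / 3) ⊆ cantorSet := by
        conv_rhs => rw [h3]
        exact Set.subset_union_right
      exact Set.mul_subset_mul h h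

lemma volume_cantorSet_mul_cantorSet :
    volume.real (cantorSet * cantorSet) = 3 / 2 * (5 / 9 - gapLength (2 / 3) (1 / 3)) := by
  have hfin : volume (cantorSet * cantorSet) ≠ ⊤ :=
    (isCompact_cantorSet.mul isCompact_cantorSet).measure_ne_top
  have hscale : volume.real ((1 / 3 : ℝ) • (cantorSet * cantorSet)) =
      1 / 3 * volume.real (cantorSet * cantorSet) := by
    rw [Measure.real, Measure.addHaar_smul]
    simp [Measure.real]
  have hdisj : Disjoint ((1 / 3 : ℝ) • (cantorSet * cantorSet)) (selfProduct (2 / 3) (1 / 3)) := by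
    rw [Set.disjoint_left]
    rintro _ ⟨_, ⟨x, hx, y, hy, rfl⟩, rfl⟩ h
    have h1 := (selfProduct_subset_Icc (by norm_num) (by norm_num) h).1
    obtain ⟨hx0, hx1⟩ := cantorSet_subset_unitInterval hx
    obtain ⟨hy0, hy1⟩ := cantorSet_subset_unitInterval hy
    simp only [smul_eq_mul] at h1
    nlinarith
  have h := congrArg volume.real cantorSet_mul_cantorSet
  rw [measureReal_union hdisj (measurableSet_selfProduct _ _)
    (by rw [Measure.addHaar_smul]; exact ENNReal.mul_ne_top (by simp) hfin)
    (isCompact_selfProduct _ _).measure_ne_top, hscale,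
    volume_selfProduct (by norm_num) (by norm_num)] at h
  norm_num at h ⊢
  linarith

/-! ### The measure of the product set -/

theorem theorem1 :
    |(volume ((fun p : ℝ × ℝ => p.1 * p.2) '' (cantorSet ×ˢ cantorSet))).toReal
      - (91782451 / 113374080 : ℝ)| ≤ 1 / 10 ^ 6 := by
  rw [Set.image_mul_prod]
  have h := volume_cantorSet_mul_cantorSet
  rw [Measure.real] at h
  rw [h, abs_le]
  have h1 := gapLength_right_third_le
  have h2 := le_gapLength_right_third
  constructor <;> norm_num at * <;> linarith
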